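/- Let $\Omega\subset\mathbb{R}^2$ be a bounded convex set with nonempty interior, and write $|\partial\Omega|=\mathcal{H}^1(\partial\Omega)$. Let $(\ell_i)_i$ be a countable family of closed line segments of finite total length $L=\sum_i|\ell_i|$ (so that $L=\mathcal{H}^1(\bigcup_i\ell_i)$ if the segments overlap only in sets of length zero), and suppose that $\mathcal{O}=\bigcup_i\ell_i$ is opaque for $\Omega$: every line that intersects $\Omega$ also intersects $\mathcal{O}$. Let $\mathbb{T}=\mathbb{R}/2\pi\mathbb{Z}$ and define two measures on $\mathbb{T}$ by $$\mu_{\mathcal{O}}=\sum_i\frac{|\ell_i|}{2}\left(\delta_{\alpha_i}+\delta_{\pi+\alpha_i}\right),\qquad \mu_{\partial\Omega}=\frac12\int_{\partial\Omega}\frac{\delta_{\tau(x)}+\delta_{\pi+\tau(x)}}{2}\,d\mathcal{H}^1(x),$$ where $\alpha_i$ is the angle that $\ell_i$ makes with the $x$-axis and $\tau(x)$ is the angle that the tangent line of $\partial\Omega$ at $x$ makes with the $x$-axis; this tangent line exists at $\mathcal{H}^1$-almost every point $x\in\partial\Omega$. For a finite signed measure $\nu$ on $\mathbb{T}$ let $$\widehat{\nu}(k)=\frac{1}{\sqrt{2\pi}}\int_{\mathbb{T}}e^{-ik\theta}\,d\nu(\theta)\quad(k\in\mathbb{Z}),\qquad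 \|\nu\|_{\dot H^{-2}(\mathbb{T})}=\Bigl(\sum_{k\in\mathbb{Z},\,k\neq0}\frac{|\widehat{\nu}(k)|^2}{k^4}\Bigr)^{1/2}.$$ Then $|\partial\Omega|/2\le L$ and $$\left\|\mu_{\mathcal{O}}-\mu_{\partial\Omega}\right\|_{\dot H^{-2}(\mathbb{T})}\le\frac{L^{1/4}}{\sqrt2}\left(L-\frac{|\partial\Omega|}{2}\right)^{3/4}.$$ -/

import Mathlib

open MeasureTheory
open scoped ENNReal

noncomputable section

namespace Opaque

/-- The Euclidean plane. -/
abbrev Plane : Type := EuclideanSpace ℝ (Fin 2)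

/-- The circle `ℝ / 2πℤ` of angles. -/
abbrev Torus : Type := AddCircle (2 * Real.pi)

/-- The unit vector making the angle `α` with the `x`-axis. -/
def unitVec (α : ℝ) : Plane := !₂[Real.cos α, Real.sin α]

/-- The angle (with values in `(-π, π]`) that a vector makes with the `x`-axis; it is `0` for the
zero vector. -/
def angle (v : Plane) : ℝ := Complex.arg ⟨v 0, v 1⟩

/-- `O` is opaque for `Ω`: every line that intersects `Ω` also intersects `O`. -/
def IsOpaque (Ω O : Set Plane) : Prop :=
  ∀ l : AffineSubspace ℝ Plane, Module.finrank ℝ l.direction = 1 →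
    ((l : Set Plane) ∩ Ω).Nonempty → ((l : Set Plane) ∩ O).Nonempty

/-- The symmetrized unit mass `(δ_α + δ_{π + α}) / 2`. -/
def twoSidedDirac (α : ℝ) : Measure Torus :=
  (1 / 2 : ℝ≥0∞) • (Measure.dirac (α : Torus) + Measure.dirac ((Real.pi + α : ℝ) : Torus))

/-- The angular orientation measure of the family of segments `[p i, q i]`: the segment `[p i, q i]`
of length `|ℓ|` and angle `α` contributes `|ℓ| / 2 • δ_α + |ℓ| / 2 • δ_{π + α}`. -/
def segmentsMeasure {ι : Type*} (p q : ι → Plane) : Measure Torus :=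
  Measure.sum fun i => ENNReal.ofReal (dist (p i) (q i)) • twoSidedDirac (angle (q i - p i))

/-- The length `|∂Ω|` of the boundary. -/
def perimeter (Ω : Set Plane) : ℝ≥0∞ := Measure.hausdorffMeasure 1 (frontier Ω)

/-- The angles in `[0, π]` of the tangent (that is, supporting) lines at `x` of the convex
set `Ω`: the line through `x` in direction `α` does not meet the interior. -/
def tangentAngles (Ω : Set Plane) (x : Plane) : Set ℝ :=
  {α | α ∈ Set.Icc 0 Real.pi ∧ ∀ t : ℝ, x + t • unitVec α ∉ interior Ω}

/-- The angle in `[0, π]` of the tangent line at the boundary point `x`. Where the boundary is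
differentiable, that is at all but countably many boundary points, there is exactly one tangent line
(the infimum only selects `0` among `0` and `π` if it is horizontal). At the remaining points the
choice does not matter, as their set has length zero. -/
def tangentAngle (Ω : Set Plane) (x : Plane) : ℝ := sInf (tangentAngles Ω x)

/-- The measure `μ_∂Ω`: each infinitesimal piece `ds` of the boundary, with tangent angle `α`,
contributes `ds / 2 • δ_α + ds / 2 • δ_{π + α}`, and the result is divided by `2`. -/
def boundaryMeasure (Ω : Set Plane) : Measure Torus :=
  (1 / 2 : ℝ≥0∞) • (1 / 2 : ℝ≥0∞) •
    (((Measure.hausdorffMeasure 1).restrict (frontier Ω)).map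
        (fun x => (tangentAngle Ω x : Torus)) +
      ((Measure.hausdorffMeasure 1).restrict (frontier Ω)).map
        (fun x => ((Real.pi + tangentAngle Ω x : ℝ) : Torus)))

/-- The Fourier coefficient of a finite measure on the circle with respect to the orthonormal system
`e^{iℓθ} / √(2π)`. -/
def fourierCoeffMeasure (μ : Measure Torus) (l : ℤ) : ℂ :=
  (1 / Real.sqrt (2 * Real.pi) : ℝ) * ∫ θ, fourier (-l) θ ∂μ

/-- The homogeneous Sobolev norm in `Ḣ^{-2}(𝕋)` of the difference `μ - ν` of two finite measures;
its Fourier coefficients are the differences of those of `μ` and `ν`. -/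
def hNegTwoDist (μ ν : Measure Torus) : ℝ :=
  Real.sqrt (∑' l : {l : ℤ // l ≠ 0},
    ‖fourierCoeffMeasure μ l - fourierCoeffMeasure ν l‖ ^ 2 / ((l : ℤ) : ℝ) ^ 4)

/-- The series that defines the norm always converges. -/
theorem summable_hNegTwoDist (μ ν : Measure Torus) :
    Summable fun l : {l : ℤ // l ≠ 0} =>
      ‖fourierCoeffMeasure μ l - fourierCoeffMeasure ν l‖ ^ 2 / ((l : ℤ) : ℝ) ^ 4 := by
  have hb : ∀ μ : Measure Torus, ∃ C, ∀ l : ℤ, ‖fourierCoeffMeasure μ l‖ ≤ C := by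
    intro μ
    refine ⟨‖((1 / Real.sqrt (2 * Real.pi) : ℝ) : ℂ)‖ * μ.real Set.univ, fun l => ?_⟩
    rw [fourierCoeffMeasure, norm_mul]
    refine mul_le_mul_of_nonneg_left ?_ (norm_nonneg _)
    refine (norm_integral_le_integral_norm _).trans ?_
    simp only [fourier_apply, Circle.norm_coe]
    simp
  obtain ⟨C, hC⟩ := hb μ
  obtain ⟨D, hD⟩ := hb ν
  have h4 : Summable fun l : ℤ => (C + D) ^ 2 * (1 / (l : ℝ) ^ 4) :=
    (Real.summable_one_div_int_pow.2 (by norm_num)).mul_left _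
  refine Summable.of_nonneg_of_le (fun l => by positivity) (fun l => ?_)
    (h4.comp_injective Subtype.val_injective)
  simp only [Function.comp]
  rw [mul_one_div]
  gcongr
  exact (norm_sub_le _ _).trans (add_le_add (hC _) (hD _))

/-- The total mass of the angular orientation measure is the total length of the segments. -/
theorem segmentsMeasure_univ {ι : Type*} (p q : ι → Plane) :
    segmentsMeasure p q Set.univ = ∑' i, ENNReal.ofReal (dist (p i) (q i)) := by
  simp only [segmentsMeasure, twoSidedDirac, Measure.sum_apply _ MeasurableSet.univ]
  congr 1
  ext i
  simp only [Measure.smul_apply, Measure.add_apply, measure_univ, smul_eq_mul]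
  rw [one_add_one_eq_two, one_div, ENNReal.inv_mul_cancel two_ne_zero ENNReal.ofNat_ne_top, mul_one]

/-- If the segments overlap in sets of length zero only, the sum of their lengths is the length of
their union. -/
theorem hausdorffMeasure_iUnion_segment {ι : Type*} [Countable ι] (p q : ι → Plane)
    (h : Pairwise fun i j => Measure.hausdorffMeasure (X := Plane) 1
      (segment ℝ (p i) (q i) ∩ segment ℝ (p j) (q j)) = 0) :
    Measure.hausdorffMeasure 1 (⋃ i, segment ℝ (p i) (q i)) =
      ∑' i, ENNReal.ofReal (dist (p i) (q i)) := by
  rw [measure_iUnion₀ h]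
  · simp [hausdorffMeasure_segment, edist_dist]
  · intro i
    refine (IsCompact.isClosed ?_).measurableSet.nullMeasurableSet
    rw [segment_eq_image]
    exact isCompact_Icc.image (by fun_prop)

/-- The tangent angle is measurable along the boundary. -/
theorem aemeasurable_tangentAngle {Ω : Set Plane} (hconv : Convex ℝ Ω)
    (hbdd : Bornology.IsBounded Ω) :
    AEMeasurable (tangentAngle Ω)
      ((Measure.hausdorffMeasure 1).restrict (frontier Ω)) := by
  have hcpt : IsCompact (frontier Ω) :=
    Metric.isCompact_of_isClosed_isBounded isClosed_frontier
      (hbdd.closure.subset frontier_subset_closure)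
  have hu : Continuous unitVec := by unfold unitVec; fun_prop
  have hcl : IsClosed {z : Plane × ℝ | ∀ t : ℝ, z.1 + t • unitVec z.2 ∉ interior Ω} := by
    simp only [Set.ofPred_forall]
    refine isClosed_iInter fun t => ?_
    exact isOpen_interior.isClosed_compl.preimage (by fun_prop)
  have hclx : ∀ x, IsCompact (tangentAngles Ω x) := fun x =>
    isCompact_Icc.inter_right (hcl.preimage (f := fun α : ℝ => (x, α)) (by fun_prop))
  -- existence of a supporting line
  have hne : ∀ x ∈ frontier Ω, (tangentAngles Ω x).Nonempty := by
    intro x hx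
    obtain ⟨f, hf⟩ := geometric_hahn_banach_open_point hconv.interior isOpen_interior hx.2
    set a := f (unitVec 0) with ha
    set b := f (unitVec (Real.pi / 2)) with hb
    have hfu : ∀ α, f (unitVec α) = Real.cos α * a + Real.sin α * b := by
      intro α
      have : unitVec α = Real.cos α • unitVec 0 + Real.sin α • unitVec (Real.pi / 2) := by
        ext i; fin_cases i <;> simp [unitVec]
      rw [this, map_add, map_smul, map_smul, smul_eq_mul, smul_eq_mul]
    have hc : ContinuousOn (fun α => f (unitVec α)) (Set.uIcc 0 Real.pi) := by fun_prop
    have h0 : (0 : ℝ) ∈ Set.uIcc (f (unitVec 0)) (f (unitVec Real.pi)) := by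
      have : f (unitVec Real.pi) = - f (unitVec 0) := by rw [hfu]; simp [ha]
      rw [this, Set.mem_uIcc]
      rcases le_total (f (unitVec 0)) 0 with h | h
      · left; constructor <;> linarith
      · right; constructor <;> linarith
    obtain ⟨α, hα, hα0⟩ := intermediate_value_uIcc hc h0
    rw [Set.uIcc_of_le Real.pi_pos.le] at hα
    refine ⟨α, hα, fun t ht => ?_⟩
    have := hf _ ht
    simp only [map_add, map_smul] at this
    rw [show f (unitVec α) = 0 from hα0] at this
    simp at this
  refine aemeasurable_restrict_of_measurable_subtype isClosed_frontier.measurableSet ?_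
  refine measurable_of_Iic fun c => ?_
  have hK : IsCompact ((frontier Ω ×ˢ Set.Icc 0 Real.pi) ∩
      ({z : Plane × ℝ | ∀ t : ℝ, z.1 + t • unitVec z.2 ∉ interior Ω} ∩ {z | z.2 ≤ c})) :=
    (hcpt.prod isCompact_Icc).inter_right
      (hcl.inter (isClosed_le continuous_snd continuous_const))
  have him := (hK.image continuous_fst).isClosed.measurableSet
  convert measurable_subtype_coe him using 1
  ext ⟨x, hx⟩
  simp only [Set.mem_preimage, Set.mem_Iic, Set.mem_image, Prod.exists]
  constructor
  · intro h
    have hm : tangentAngle Ω x ∈ tangentAngles Ω x := (hclx x).sInf_mem (hne x hx)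
    exact ⟨x, _, ⟨⟨hx, hm.1⟩, hm.2, h⟩, rfl⟩
  · rintro ⟨y, α, ⟨⟨_, h1⟩, h2, h3⟩, rfl⟩
    exact (show tangentAngle Ω y ≤ α from
      csInf_le ⟨0, fun β (hβ : β ∈ tangentAngles Ω y) => hβ.1.1⟩ ⟨h1, h2⟩).trans h3

/-- The total mass of `μ_∂Ω` is half of the length of the boundary. -/
theorem boundaryMeasure_univ {Ω : Set Plane} (hconv : Convex ℝ Ω)
    (hbdd : Bornology.IsBounded Ω) :
    boundaryMeasure Ω Set.univ = perimeter Ω / 2 := by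
  have hm := aemeasurable_tangentAngle hconv hbdd
  have hq : Measurable fun r : ℝ => (r : Torus) := (AddCircle.continuous_mk' _).measurable
  have h1 : AEMeasurable (fun x => (tangentAngle Ω x : Torus))
      ((Measure.hausdorffMeasure 1).restrict (frontier Ω)) := hq.comp_aemeasurable hm
  have h2 : AEMeasurable (fun x => ((Real.pi + tangentAngle Ω x : ℝ) : Torus))
      ((Measure.hausdorffMeasure 1).restrict (frontier Ω)) :=
    hq.comp_aemeasurable (hm.const_add _)
  simp only [boundaryMeasure, Measure.smul_apply, Measure.add_apply,
    Measure.map_apply_of_aemeasurable h1 MeasurableSet.univ,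
    Measure.map_apply_of_aemeasurable h2 MeasurableSet.univ, Set.preimage_univ,
    Measure.restrict_apply_univ, smul_eq_mul, perimeter]
  rw [← two_mul, ← mul_assoc (1 / 2 : ℝ≥0∞) 2, one_div,
    ENNReal.inv_mul_cancel two_ne_zero ENNReal.ofNat_ne_top, one_mul, mul_comm, div_eq_mul_inv]

end Opaque

end

noncomputable section

namespace Opaque

/-! Everything is read off from the convolution of the two measures with `|cos|`. Let `w(θ)` be the
length of the projection of `Ω` to the direction `θ`. A line orthogonal to `θ` that meets `Ω` meets
a segment, so the projections of the segments cover that of `Ω`, and `w(θ) ≤ ∑ |ℓ_i| |cos(θ -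
α_i)|`, the transform of the segment measure. Cauchy's formula identifies `w` with the transform of
the boundary measure; only the inequality `transform ≤ w` is needed. Hence the difference `g` of the
two transforms is nonnegative.

Put `δ = L - |∂Ω|/2`. The mean of `g` is `(2/π) δ`, which already gives `|∂Ω|/2 ≤ L`. Moreover `g`
is `π`-periodic and `2L`-Lipschitz, so the triangle of slope `2L` under its graph at a point `x` has
area `g(x)²/(2L)`, at most the integral `2δ` over a period (`cosTransform_sub_sq_le`). Thus `sup g ≤
2 √(Lδ)`, and the mean of `g²` is at most `sup g` times the mean of `g`.

The Fourier coefficients of `|cos|` at `2m` have size `2/(π(4m² - 1))`, slightly more than the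
weight `1/k²` of the norm requires, and the odd coefficients of both measures vanish by symmetry. So
Parseval bounds the squared norm by `π/8` times the mean of `g²` (`hNegTwoDist_sq_le`), and the
constants multiply to `L^(1/2) δ^(3/2) / 2`. -/

/-! ### Coordinates in a rotated frame -/

/-- The coordinate of a vector in the direction of angle `θ`. -/
def coord (θ : ℝ) : Plane →L[ℝ] ℝ := innerSL ℝ (unitVec θ)

theorem coord_apply (θ : ℝ) (v : Plane) :
    coord θ v = Real.cos θ * v 0 + Real.sin θ * v 1 := by
  simp [coord, unitVec, PiLp.inner_apply, Fin.sum_univ_two]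
  ring

theorem coord_unitVec (θ α : ℝ) : coord θ (unitVec α) = Real.cos (α - θ) := by
  rw [coord_apply, Real.cos_sub]
  simp [unitVec]
  ring

theorem continuous_coord_left (v : Plane) : Continuous fun θ => coord θ v := by
  simp only [coord_apply]
  fun_prop

theorem coord_add_pi (θ : ℝ) (v : Plane) : coord (θ + Real.pi) v = -coord θ v := by
  simp only [coord_apply, Real.cos_add_pi, Real.sin_add_pi]
  ring

theorem coord_sub_pi_div_two (θ : ℝ) (v : Plane) :
    coord (θ - Real.pi / 2) v = -coord (θ + Real.pi / 2) v := by
  rw [← coord_add_pi]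
  simp only [coord_apply]
  rw [show θ + Real.pi / 2 + Real.pi = θ - Real.pi / 2 + 2 * Real.pi by ring,
    Real.cos_add_two_pi, Real.sin_add_two_pi]

theorem coord_smul_add (θ : ℝ) (v : Plane) :
    coord θ v • unitVec θ + coord (θ + Real.pi / 2) v • unitVec (θ + Real.pi / 2) = v := by
  have h := Real.sin_sq_add_cos_sq θ
  ext i
  fin_cases i
  · simp [coord_apply, unitVec, Real.cos_add_pi_div_two, Real.sin_add_pi_div_two]
    linear_combination v 0 * h
  · simp [coord_apply, unitVec, Real.cos_add_pi_div_two, Real.sin_add_pi_div_two]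
    linear_combination v 1 * h

theorem norm_unitVec (θ : ℝ) : ‖unitVec θ‖ = 1 := by
  simp [EuclideanSpace.norm_eq, unitVec, Fin.sum_univ_two]

theorem abs_coord_eq_of_coord_eq_zero {φ : ℝ} {v : Plane} (h : coord φ v = 0) (θ : ℝ) :
    |coord θ v| = ‖v‖ * |Real.sin (φ - θ)| := by
  have hv := coord_smul_add φ v
  rw [h, zero_smul, zero_add] at hv
  rw [← hv, map_smul, coord_unitVec, norm_smul, norm_unitVec, smul_eq_mul, abs_mul,
    Real.norm_eq_abs, mul_one,
    show φ + Real.pi / 2 - θ = φ - θ + Real.pi / 2 by ring, Real.cos_add_pi_div_two, abs_neg]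

theorem coord_angle (θ : ℝ) (v : Plane) : coord θ v = ‖v‖ * Real.cos (θ - angle v) := by
  have hn : ‖v‖ = ‖(⟨v 0, v 1⟩ : ℂ)‖ := by
    rw [EuclideanSpace.norm_eq, Complex.norm_eq_sqrt_sq_add_sq]
    simp [Fin.sum_univ_two]
  have hc := Complex.norm_mul_cos_arg ⟨v 0, v 1⟩
  have hs := Complex.norm_mul_sin_arg ⟨v 0, v 1⟩
  simp only at hc hs
  rw [coord_apply, Real.cos_sub, angle, hn]
  linear_combination -(Real.cos θ) * hc - Real.sin θ * hs

/-! ### Projections of opaque sets -/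

theorem volume_coord_image_segment (θ : ℝ) (p q : Plane) :
    volume (coord θ '' segment ℝ p q) =
      ENNReal.ofReal (dist p q * |Real.cos (θ - angle (q - p))|) := by
  have h : coord θ '' segment ℝ p q = segment ℝ (coord θ p) (coord θ q) :=
    image_segment ℝ (coord θ).toLinearMap.toAffineMap p q
  rw [h, segment_eq_uIcc, Real.volume_interval, ← map_sub, coord_angle, abs_mul, abs_norm,
    dist_comm, dist_eq_norm]

theorem volume_coord_image_le_of_isOpaque {ι : Type*} [Countable ι] {Ω : Set Plane}
    {p q : ι → Plane} (hO : IsOpaque Ω (⋃ i, segment ℝ (p i) (q i))) (θ : ℝ) :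
    volume (coord θ '' Ω) ≤
      ∑' i, ENNReal.ofReal (dist (p i) (q i) * |Real.cos (θ - angle (q i - p i))|) := by
  have hsub : coord θ '' Ω ⊆ ⋃ i, coord θ '' segment ℝ (p i) (q i) := by
    rintro _ ⟨x, hx, rfl⟩
    set w := unitVec (θ + Real.pi / 2) with hw
    have hw0 : w ≠ 0 := by
      intro h
      have := norm_unitVec (θ + Real.pi / 2)
      rw [← hw, h, norm_zero] at this
      exact zero_ne_one this
    -- Opacity is used on the line through `x` orthogonal to `θ`: all its points have the same
    -- coordinate as `x`.
    obtain ⟨y, hyl, hyO⟩ := hO (AffineSubspace.mk' x (Submodule.span ℝ {w}))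
      (by rw [AffineSubspace.direction_mk']; exact finrank_span_singleton hw0)
      ⟨x, AffineSubspace.self_mem_mk' _ _, hx⟩
    obtain ⟨c, hc⟩ := Submodule.mem_span_singleton.1 (AffineSubspace.mem_mk'.1 hyl)
    obtain ⟨i, hi⟩ := Set.mem_iUnion.1 hyO
    refine Set.mem_iUnion.2 ⟨i, y, hi, ?_⟩
    have : coord θ (y - x) = 0 := by
      rw [← vsub_eq_sub, ← hc, map_smul, hw, coord_unitVec]
      simp
    rw [map_sub] at this
    linarith
  refine (measure_mono hsub).trans ((measure_iUnion_le _).trans_eq ?_)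
  simp only [volume_coord_image_segment]

/-! ### Length of sets with a monotone field of normals -/

/-- For `k > 0` the inverse of `f` on `f '' A` is `k⁻¹`-Lipschitz, and such maps enlarge length by
at most `k⁻¹`. For `k ≤ 0` the left side is zero. -/
theorem ofReal_mul_hausdorffMeasure_le {X : Type*} [MetricSpace X] [Nonempty X]
    [MeasurableSpace X] [BorelSpace X] {f : X → ℝ} {A : Set X} {k : ℝ}
    (h : ∀ x ∈ A, ∀ y ∈ A, k * dist x y ≤ |f x - f y|) :
    ENNReal.ofReal k * Measure.hausdorffMeasure 1 A ≤ volume (f '' A) := by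
  rcases le_or_gt k 0 with hk | hk
  · simp [ENNReal.ofReal_of_nonpos hk]
  have hinj : Set.InjOn f A := by
    intro x hx y hy hxy
    have := h x hx y hy
    rw [hxy, sub_self, abs_zero] at this
    exact dist_le_zero.1 (nonpos_of_mul_nonpos_right this hk)
  have hL : LipschitzOnWith (Real.toNNReal k⁻¹) (Function.invFunOn f A) (f '' A) := by
    refine LipschitzOnWith.of_dist_le_mul ?_
    rintro _ ⟨x, hx, rfl⟩ _ ⟨y, hy, rfl⟩
    rw [hinj.leftInvOn_invFunOn hx, hinj.leftInvOn_invFunOn hy, Real.coe_toNNReal _ (by positivity),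
      Real.dist_eq, inv_mul_eq_div, le_div_iff₀ hk, mul_comm]
    exact h x hx y hy
  have := hL.hausdorffMeasure_image_le zero_le_one
  rw [hinj.invFunOn_image subset_rfl, hausdorffMeasure_real, ENNReal.rpow_one] at this
  calc ENNReal.ofReal k * Measure.hausdorffMeasure 1 A
      ≤ ENNReal.ofReal k * (ENNReal.ofReal k⁻¹ * volume (f '' A)) := by gcongr; exact this
    _ = volume (f '' A) := by
      rw [← mul_assoc, ← ENNReal.ofReal_mul hk.le, mul_inv_cancel₀ hk.ne', ENNReal.ofReal_one,
        one_mul]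

/-- `η` is a field of angles of outer normals of supporting lines along `A`. -/
def IsNormalField (A : Set Plane) (η : Plane → ℝ) : Prop :=
  ∀ x ∈ A, ∀ y ∈ A, coord (η x) (y - x) ≤ 0

theorem IsNormalField.mono {A B : Set Plane} {η : Plane → ℝ} (h : IsNormalField B η)
    (hAB : A ⊆ B) : IsNormalField A η :=
  fun x hx y hy => h x (hAB hx) y (hAB hy)

theorem abs_abs_sin_sub_abs_sin_le (a b : ℝ) :
    |(|Real.sin a| - |Real.sin b|)| ≤ |a - b| :=
  (abs_abs_sub_abs_le _ _).trans (by
    simpa [Real.dist_eq] using Real.lipschitzWith_sin.dist_le_mul a b)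

/-- A discrete mean value theorem: `y - x` has nonpositive coordinate in direction `η x` and
nonnegative one in direction `η y`, so it is orthogonal to some intermediate direction `φ`. Its
projection then has length `‖y - x‖ |sin(φ - θ)|`, and `φ` is within `ε` of `β`. -/
theorem IsNormalField.abs_sub_mul_dist_le {A : Set Plane} {η : Plane → ℝ}
    (h : IsNormalField A η) {β ε : ℝ} (hA : ∀ x ∈ A, η x ∈ Set.Icc β (β + ε)) (θ : ℝ)
    {x y : Plane} (hx : x ∈ A) (hy : y ∈ A) :
    (|Real.sin (β - θ)| - ε) * dist x y ≤ |coord θ x - coord θ y| := by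
  have h1 := h x hx y hy
  have h2 : 0 ≤ coord (η y) (y - x) := by
    have := h y hy x hx
    rw [← neg_sub, map_neg] at this
    linarith
  obtain ⟨φ, hφ, h0⟩ := intermediate_value_uIcc
    (continuous_coord_left (y - x)).continuousOn (Set.mem_uIcc.2 (Or.inl ⟨h1, h2⟩))
  have hφ' : φ ∈ Set.Icc β (β + ε) := Set.uIcc_subset_Icc (hA x hx) (hA y hy) hφ
  have hd := abs_coord_eq_of_coord_eq_zero h0 θ
  rw [← dist_eq_norm, dist_comm] at hd
  rw [← map_sub, ← neg_sub y x, map_neg, abs_neg, hd, mul_comm]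
  refine mul_le_mul_of_nonneg_left ?_ dist_nonneg
  have := abs_abs_sin_sub_abs_sin_le (β - θ) (φ - θ)
  rw [sub_sub_sub_cancel_right] at this
  have h3 := (abs_le.1 this).2
  have h4 : |β - φ| ≤ ε := abs_le.2 ⟨by linarith [hφ'.2], by linarith [hφ'.1, hφ'.2]⟩
  linarith

theorem IsNormalField.lintegral_abs_sin_le {A : Set Plane} {η : Plane → ℝ}
    (h : IsNormalField A η) {β ε : ℝ} (hε : 0 ≤ ε)
    (hA : ∀ x ∈ A, η x ∈ Set.Icc β (β + ε)) (θ : ℝ) :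
    ∫⁻ x in A, ENNReal.ofReal |Real.sin (η x - θ)| ∂Measure.hausdorffMeasure 1 ≤
      volume (coord θ '' A) + ENNReal.ofReal (2 * ε) * Measure.hausdorffMeasure 1 A := by
  have h1 : ∫⁻ x in A, ENNReal.ofReal |Real.sin (η x - θ)| ∂Measure.hausdorffMeasure 1 ≤
      ∫⁻ x in A, ENNReal.ofReal (|Real.sin (β - θ)| + ε) ∂Measure.hausdorffMeasure 1 := by
    refine setLIntegral_mono measurable_const fun x hx => ENNReal.ofReal_le_ofReal ?_
    have := abs_abs_sin_sub_abs_sin_le (η x - θ) (β - θ)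
    rw [sub_sub_sub_cancel_right] at this
    have h3 := (abs_le.1 this).2
    have h4 : |η x - β| ≤ ε :=
      abs_le.2 ⟨by linarith [(hA x hx).1], by linarith [(hA x hx).2]⟩
    linarith
  rw [setLIntegral_const] at h1
  refine h1.trans ?_
  calc ENNReal.ofReal (|Real.sin (β - θ)| + ε) * Measure.hausdorffMeasure 1 A
      -- The integrand exceeds the sine at `β` by at most `ε`, the expansion constant falls short of
      -- it by `ε`; hence the error `2 * ε`.
      ≤ (ENNReal.ofReal (|Real.sin (β - θ)| - ε) + ENNReal.ofReal (2 * ε)) *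
        Measure.hausdorffMeasure 1 A := by
        gcongr
        refine le_trans (ENNReal.ofReal_le_ofReal ?_) ENNReal.ofReal_add_le
        linarith
    _ ≤ _ := by
        rw [add_mul]
        gcongr
        exact ofReal_mul_hausdorffMeasure_le fun x hx y hy => h.abs_sub_mul_dist_le hA θ hx hy

/-- Slice `S` by the value of `η` into windows of width `ε`. Injectivity keeps the projections of
the slices disjoint, so the slice estimates add up, with a total error of `2ε` times the length of
`S`; then `ε → 0`. -/
theorem IsNormalField.lintegral_abs_sin_le_volume {S : Set Plane} {η : Plane → ℝ}
    (h : IsNormalField S η) (hSm : MeasurableSet S) (hη : Measurable η)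
    (hfin : Measure.hausdorffMeasure 1 S ≠ ∞) {θ : ℝ} (hinj : Set.InjOn (coord θ) S) :
    ∫⁻ x in S, ENNReal.ofReal |Real.sin (η x - θ)| ∂Measure.hausdorffMeasure 1 ≤
      volume (coord θ '' S) := by
  have key : ∀ ε : ℝ, 0 < ε →
      ∫⁻ x in S, ENNReal.ofReal |Real.sin (η x - θ)| ∂Measure.hausdorffMeasure 1 ≤
        volume (coord θ '' S) + ENNReal.ofReal (2 * ε) * Measure.hausdorffMeasure 1 S := by
    intro ε hε
    set A : ℤ → Set Plane := fun j => S ∩ (fun x => ⌊η x / ε⌋) ⁻¹' {j} with hAdef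
    have hAm : ∀ j, MeasurableSet (A j) := fun j =>
      hSm.inter ((Int.measurable_floor.comp (hη.div_const ε)) (measurableSet_singleton j))
    have hAS : ∀ j, A j ⊆ S := fun j => Set.inter_subset_left
    have hdisj : Pairwise (Function.onFun Disjoint A) := by
      intro i j hij
      refine Set.disjoint_left.2 fun x hx hx' => hij ?_
      exact hx.2.symm.trans hx'.2
    have hU : ⋃ j, A j = S := by
      ext x
      simp [hAdef]
    have hImDisj : Pairwise (Function.onFun Disjoint fun j => coord θ '' A j) := by
      intro i j hij
      refine Set.disjoint_left.2 ?_
      rintro _ ⟨x, hx, rfl⟩ ⟨y, hy, hxy⟩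
      have := hinj (hAS j hy) (hAS i hx) hxy
      subst this
      exact Set.disjoint_left.1 (hdisj hij) hx hy
    have hAη : ∀ j, ∀ x ∈ A j, η x ∈ Set.Icc (j * ε) (j * ε + ε) := by
      intro j x hx
      have hj : ⌊η x / ε⌋ = j := hx.2
      obtain ⟨h1, h2⟩ := Int.floor_eq_iff.1 hj
      rw [le_div_iff₀ hε] at h1
      rw [div_lt_iff₀ hε] at h2
      exact ⟨h1, by linarith⟩
    calc ∫⁻ x in S, ENNReal.ofReal |Real.sin (η x - θ)| ∂Measure.hausdorffMeasure 1
        = ∑' j, ∫⁻ x in A j, ENNReal.ofReal |Real.sin (η x - θ)| ∂Measure.hausdorffMeasure 1 := by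
          rw [← lintegral_iUnion hAm hdisj, hU]
      _ ≤ ∑' j, (volume (coord θ '' A j) +
            ENNReal.ofReal (2 * ε) * Measure.hausdorffMeasure 1 (A j)) :=
          ENNReal.tsum_le_tsum fun j =>
            (h.mono (hAS j)).lintegral_abs_sin_le hε.le (hAη j) θ
      _ = _ := by
          rw [ENNReal.tsum_add, ENNReal.tsum_mul_left, ← measure_iUnion hdisj hAm, hU,
            ← measure_iUnion hImDisj fun j => (hAm j).image_of_continuousOn_injOn
              (coord θ).continuous.continuousOn (hinj.mono (hAS j)), ← Set.image_iUnion, hU]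
  refine ENNReal.le_of_forall_pos_le_add fun ε hε _ => ?_
  set M := (Measure.hausdorffMeasure 1 S).toReal with hM
  have hM0 : 0 ≤ M := ENNReal.toReal_nonneg
  -- The summand `1` keeps the denominator positive when `M = 0`.
  refine (key (ε / (2 * (M + 1))) (by positivity)).trans ?_
  gcongr
  rw [← ENNReal.ofReal_toReal hfin, ← hM, ← ENNReal.ofReal_mul (by positivity),
    ← ENNReal.ofReal_coe_nnreal]
  refine ENNReal.ofReal_le_ofReal ?_
  have : 2 * ((ε : ℝ) / (2 * (M + 1))) * M = ε * (M / (M + 1)) := by field_simp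
  rw [this]
  exact mul_le_of_le_one_right ε.2 ((div_le_one (by positivity)).2 (by linarith))

/-- Two points with equal projection differ by `s` times the unit vector orthogonal to `θ`. The
normal conditions at them read `s sin(η x - θ) ≤ 0` and `s sin(η y - θ) ≥ 0`; sines of one strict
sign force `s = 0`. -/
theorem IsNormalField.injOn_coord {S : Set Plane} {η : Plane → ℝ} (h : IsNormalField S η) {θ : ℝ}
    (hpos : (∀ x ∈ S, 0 < Real.sin (η x - θ)) ∨ (∀ x ∈ S, Real.sin (η x - θ) < 0)) :
    Set.InjOn (coord θ) S := by
  intro x hx y hy hxy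
  have h0 : coord θ (y - x) = 0 := by rw [map_sub, hxy, sub_self]
  have hv := coord_smul_add θ (y - x)
  rw [h0, zero_smul, zero_add] at hv
  set s := coord (θ + Real.pi / 2) (y - x) with hs
  have hc : ∀ z, coord (η z) (unitVec (θ + Real.pi / 2)) = Real.sin (η z - θ) := by
    intro z
    rw [coord_unitVec, ← Real.cos_neg, show -(θ + Real.pi / 2 - η z) = η z - θ - Real.pi / 2 by ring,
      Real.cos_sub_pi_div_two]
  have h1 := h x hx y hy
  have h2 := h y hy x hx
  rw [← hv, map_smul, hc, smul_eq_mul] at h1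
  rw [← neg_sub y x, ← hv, map_neg, map_smul, hc, smul_eq_mul] at h2
  have hs0 : s = 0 := by
    rcases hpos with hp | hp
    · have := hp x hx; have := hp y hy
      nlinarith
    · have := hp x hx; have := hp y hy
      nlinarith
  rw [hs0, zero_smul] at hv
  exact (sub_eq_zero.1 hv.symm).symm

/-- One half of Cauchy's formula for the width. -/
theorem IsNormalField.lintegral_abs_sin_le_two_mul {G : Set Plane} {η : Plane → ℝ}
    (h : IsNormalField G η) (hGm : MeasurableSet G) (hη : Measurable η)
    (hfin : Measure.hausdorffMeasure 1 G ≠ ∞) (θ : ℝ) :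
    ∫⁻ x in G, ENNReal.ofReal |Real.sin (η x - θ)| ∂Measure.hausdorffMeasure 1 ≤
      2 * volume (coord θ '' G) := by
  have hm : Measurable fun x => Real.sin (η x - θ) := Real.measurable_sin.comp (hη.sub_const θ)
  have hP : MeasurableSet (G ∩ {x | 0 < Real.sin (η x - θ)}) :=
    hGm.inter (hm measurableSet_Ioi)
  have hN : MeasurableSet (G ∩ {x | Real.sin (η x - θ) < 0}) :=
    hGm.inter (hm measurableSet_Iio)
  have hZ : MeasurableSet (G ∩ {x | Real.sin (η x - θ) = 0}) :=
    hGm.inter (hm (measurableSet_singleton 0))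
  have hcover : G ⊆ (G ∩ {x | 0 < Real.sin (η x - θ)} ∪ G ∩ {x | Real.sin (η x - θ) < 0}) ∪
      G ∩ {x | Real.sin (η x - θ) = 0} := by
    intro x hx
    rcases lt_trichotomy 0 (Real.sin (η x - θ)) with h | h | h
    · exact Or.inl (Or.inl ⟨hx, h⟩)
    · exact Or.inr ⟨hx, h.symm⟩
    · exact Or.inl (Or.inr ⟨hx, h⟩)
  have hsub : ∀ T : Set Plane, Measure.hausdorffMeasure 1 (G ∩ T) ≠ ∞ := fun T =>
    ne_top_of_le_ne_top hfin (measure_mono Set.inter_subset_left)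
  have hz : ∫⁻ x in G ∩ {x | Real.sin (η x - θ) = 0},
      ENNReal.ofReal |Real.sin (η x - θ)| ∂Measure.hausdorffMeasure 1 = 0 := by
    rw [setLIntegral_congr_fun (g := fun _ => 0) hZ fun x hx => by
      simp [show Real.sin (η x - θ) = 0 from hx.2]]
    simp
  -- The two sides of `G` seen from direction `θ + π/2`, given by the sign of the sine, each project
  -- injectively; they account for the factor 2.
  have hone : ∀ T : Set Plane, MeasurableSet (G ∩ T) →
      (∀ x ∈ G ∩ T, 0 < Real.sin (η x - θ)) ∨ (∀ x ∈ G ∩ T, Real.sin (η x - θ) < 0) →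
      ∫⁻ x in G ∩ T, ENNReal.ofReal |Real.sin (η x - θ)| ∂Measure.hausdorffMeasure 1 ≤
        volume (coord θ '' G) := by
    intro T hT hs
    have hN := h.mono (Set.inter_subset_left (s := G) (t := T))
    exact (hN.lintegral_abs_sin_le_volume hT hη (hsub T) (hN.injOn_coord hs)).trans
      (measure_mono (Set.image_mono Set.inter_subset_left))
  refine (lintegral_mono_set hcover).trans ((lintegral_union_le _ _ _).trans ?_)
  rw [hz, add_zero, two_mul]
  refine (lintegral_union_le _ _ _).trans (add_le_add ?_ ?_)
  · exact hone _ hP (Or.inl fun x hx => hx.2)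
  · exact hone _ hN (Or.inr fun x hx => hx.2)

theorem volume_coord_image_lt_top {A : Set Plane} (hb : Bornology.IsBounded A) (θ : ℝ) :
    volume (coord θ '' A) < ∞ :=
  ((coord θ).lipschitz.isBounded_image hb).measure_lt_top

/-- Finitely many windows of width `1/2` contain all normals. Each slice, projected orthogonally to
the normal at the start of its window, contracts distances at most by the factor `1 - 1/2`, and its
projection is bounded. -/
theorem IsNormalField.hausdorffMeasure_lt_top {A : Set Plane} {η : Plane → ℝ}
    (h : IsNormalField A η) (hb : Bornology.IsBounded A)
    {a b : ℝ} (hab : ∀ x ∈ A, η x ∈ Set.Icc a b) : Measure.hausdorffMeasure 1 A < ∞ := by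
  have hcover : A ⊆ ⋃ j ∈ Finset.Icc ⌊2 * a⌋ ⌊2 * b⌋, (A ∩ {x | ⌊2 * η x⌋ = j}) := by
    intro x hx
    simp only [Set.mem_iUnion]
    refine ⟨⌊2 * η x⌋, Finset.mem_Icc.2 ⟨?_, ?_⟩, hx, rfl⟩
    · exact Int.floor_mono (by linarith [(hab x hx).1])
    · exact Int.floor_mono (by linarith [(hab x hx).2])
  refine (measure_mono hcover).trans_lt ((measure_biUnion_finset_le _ _).trans_lt
    (ENNReal.sum_lt_top.2 fun j _ => ?_))
  set B := A ∩ {x | ⌊2 * η x⌋ = j}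
  have hη : ∀ x ∈ B, η x ∈ Set.Icc ((j : ℝ) / 2) (j / 2 + 1 / 2) := by
    intro x hx
    obtain ⟨h1, h2⟩ := Int.floor_eq_iff.1 hx.2
    constructor <;> linarith
  have hN := h.mono (Set.inter_subset_left (s := A) (t := {x | ⌊2 * η x⌋ = j}))
  have := ofReal_mul_hausdorffMeasure_le fun x hx y hy =>
    hN.abs_sub_mul_dist_le hη (j / 2 - Real.pi / 2) hx hy
  have hlt := this.trans_lt
    (volume_coord_image_lt_top (hb.subset Set.inter_subset_left) (j / 2 - Real.pi / 2))
  rw [sub_sub_cancel, Real.sin_pi_div_two, abs_one] at hlt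
  exact ENNReal.lt_top_of_mul_ne_top_right hlt.ne (by norm_num)

/-! ### The boundary of a convex set -/

theorem tangentAngle_mem {Ω : Set Plane} (hconv : Convex ℝ Ω) {x : Plane}
    (hx : x ∈ frontier Ω) : tangentAngle Ω x ∈ tangentAngles Ω x := by
  have hu : Continuous unitVec := by unfold unitVec; fun_prop
  have hcl : IsClosed {α : ℝ | ∀ t : ℝ, x + t • unitVec α ∉ interior Ω} := by
    simp only [Set.ofPred_forall]
    refine isClosed_iInter fun t => ?_
    exact isOpen_interior.isClosed_compl.preimage (by fun_prop)
  refine (isCompact_Icc.inter_right hcl).sInf_mem ?_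
  -- A supporting functional changes sign between the angles `0` and `π`, so it vanishes in some
  -- direction `α`. Along that line through `x` it keeps the value `f x`, which is never attained in
  -- the interior.
  obtain ⟨f, hf⟩ := geometric_hahn_banach_open_point hconv.interior isOpen_interior hx.2
  have hfu : f (unitVec Real.pi) = -f (unitVec 0) := by
    rw [← map_neg]
    congr 1
    ext i
    fin_cases i <;> simp [unitVec]
  have h0 : (0 : ℝ) ∈ Set.uIcc (f (unitVec 0)) (f (unitVec Real.pi)) := by
    rw [hfu, Set.mem_uIcc]
    rcases le_total (f (unitVec 0)) 0 with h | h
    · left; constructor <;> linarith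
    · right; constructor <;> linarith
  obtain ⟨α, hα, hα0⟩ := intermediate_value_uIcc
    (f := fun α => f (unitVec α)) (by fun_prop) h0
  rw [Set.uIcc_of_le Real.pi_pos.le] at hα
  refine ⟨α, hα, fun t ht => ?_⟩
  have := hf _ ht
  simp only [map_add, map_smul] at this
  rw [show f (unitVec α) = 0 from hα0] at this
  simp at this

/-- The angle of the normal of the line through `x` in direction `τ x` that points away from `z`. -/
def outerNormalAngle (z : Plane) (τ : Plane → ℝ) (x : Plane) : ℝ :=
  if 0 < coord (τ x + Real.pi / 2) (z - x) then τ x - Real.pi / 2 else τ x + Real.pi / 2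

theorem measurable_outerNormalAngle (z : Plane) {τ : Plane → ℝ} (hτ : Measurable τ) :
    Measurable (outerNormalAngle z τ) := by
  refine Measurable.ite ?_ (hτ.sub_const _) (hτ.add_const _)
  refine measurableSet_lt measurable_const ?_
  simp only [coord_apply]
  have h : ∀ i : Fin 2, Measurable fun x : Plane => (z - x) i := fun i =>
    Continuous.measurable (by fun_prop)
  exact ((Real.measurable_cos.comp (hτ.add_const _)).mul (h 0)).add
    ((Real.measurable_sin.comp (hτ.add_const _)).mul (h 1))

theorem abs_sin_outerNormalAngle (z : Plane) (τ : Plane → ℝ) (x : Plane) (θ : ℝ) :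
    |Real.sin (outerNormalAngle z τ x - θ)| = |Real.cos (θ - τ x)| := by
  rw [← Real.cos_neg, neg_sub, outerNormalAngle]
  split_ifs
  · rw [sub_right_comm, Real.sin_sub_pi_div_two, abs_neg]
  · rw [add_sub_right_comm, Real.sin_add_pi_div_two]

/-- The supporting line misses the interior, which is connected, so `y` lies on the same side as the
reference point `z`. -/
theorem coord_outerNormalAngle_neg {Ω : Set Plane} (hconv : Convex ℝ Ω) {τ : Plane → ℝ}
    {x y z : Plane} (hx : τ x ∈ tangentAngles Ω x) (hy : y ∈ interior Ω) (hz : z ∈ interior Ω) :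
    coord (outerNormalAngle z τ x) (y - x) < 0 := by
  set h : Plane → ℝ := fun w => coord (τ x + Real.pi / 2) (w - x) with hh
  have hne : ∀ w ∈ interior Ω, h w ≠ 0 := by
    intro w hw h0
    refine hx.2 (coord (τ x) (w - x)) ?_
    have := coord_smul_add (τ x) (w - x)
    rw [show coord (τ x + Real.pi / 2) (w - x) = 0 from h0, zero_smul, add_zero] at this
    rwa [this, add_sub_cancel]
  have hcont : ContinuousOn h (interior Ω) := by
    have : Continuous h := (coord _).continuous.comp (continuous_id.sub continuous_const)
    exact this.continuousOn
  have hpre := hconv.interior.isPreconnected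
  rw [outerNormalAngle]
  split_ifs with hs
  · rw [coord_sub_pi_div_two, neg_lt_zero]
    by_contra hle
    obtain ⟨w, hw, hw0⟩ := hpre.intermediate_value hy hz hcont ⟨not_lt.1 hle, hs.le⟩
    exact hne w hw hw0
  · by_contra hle
    obtain ⟨w, hw, hw0⟩ := hpre.intermediate_value hz hy hcont ⟨not_lt.1 hs, not_lt.1 hle⟩
    exact hne w hw hw0

theorem isNormalField_outerNormalAngle {Ω : Set Plane} (hconv : Convex ℝ Ω) {τ : Plane → ℝ}
    {z : Plane} (hz : z ∈ interior Ω) {A : Set Plane} (hA : A ⊆ frontier Ω)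
    (hτ : ∀ x ∈ A, τ x ∈ tangentAngles Ω x) : IsNormalField A (outerNormalAngle z τ) := by
  intro x hx y hy
  have hcl : closure (interior Ω) ⊆ {w | coord (outerNormalAngle z τ x) (w - x) ≤ 0} := by
    refine closure_minimal (fun w hw => (coord_outerNormalAngle_neg hconv (hτ x hx) hw hz).le) ?_
    exact isClosed_le ((coord _).continuous.comp (continuous_id.sub continuous_const))
      continuous_const
  rw [hconv.closure_interior_eq_closure_of_nonempty_interior ⟨z, hz⟩] at hcl
  exact hcl (frontier_subset_closure (hA hy))

theorem isBounded_frontier {Ω : Set Plane} (hbdd : Bornology.IsBounded Ω) :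
    Bornology.IsBounded (frontier Ω) :=
  hbdd.closure.subset frontier_subset_closure

theorem perimeter_lt_top {Ω : Set Plane} (hconv : Convex ℝ Ω) (hbdd : Bornology.IsBounded Ω)
    (hint : (interior Ω).Nonempty) : perimeter Ω < ∞ := by
  obtain ⟨z, hz⟩ := hint
  refine (isNormalField_outerNormalAngle (τ := tangentAngle Ω) hconv hz subset_rfl
    fun x hx => tangentAngle_mem hconv hx).hausdorffMeasure_lt_top (isBounded_frontier hbdd)
    (a := -(Real.pi / 2)) (b := Real.pi + Real.pi / 2) fun x hx => ?_
  have h := (tangentAngle_mem hconv hx).1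
  have := Real.pi_pos
  rw [outerNormalAngle]
  split_ifs <;> constructor <;> linarith [h.1, h.2]

/-- The projection is a convex subset of the line, whose frontier is null. -/
theorem volume_coord_image_closure_le {Ω : Set Plane} (hconv : Convex ℝ Ω) (θ : ℝ) :
    volume (coord θ '' closure Ω) ≤ volume (coord θ '' Ω) := by
  refine (measure_mono (image_closure_subset_closure_image (coord θ).continuous)).trans ?_
  rw [closure_eq_self_union_frontier]
  refine (measure_union_le _ _).trans_eq ?_
  have hc : Convex ℝ (coord θ '' Ω) := hconv.linear_image (coord θ).toLinearMap
  rw [hc.addHaar_frontier volume, add_zero]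

theorem lintegral_abs_cos_tangentAngle_le {Ω : Set Plane} (hconv : Convex ℝ Ω)
    (hbdd : Bornology.IsBounded Ω) (hint : (interior Ω).Nonempty) (θ : ℝ) :
    ∫⁻ x in frontier Ω, ENNReal.ofReal |Real.cos (θ - tangentAngle Ω x)|
        ∂Measure.hausdorffMeasure 1 ≤ 2 * volume (coord θ '' Ω) := by
  have hperim := perimeter_lt_top hconv hbdd hint
  obtain ⟨z, hz⟩ := hint
  have hm := aemeasurable_tangentAngle hconv hbdd
  have hae := hm.ae_eq_mk
  have hτm := hm.measurable_mk
  set τ := hm.mk (tangentAngle Ω) with hτ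
  -- The tangent angle is only almost everywhere measurable. Off the null set `N` it equals the
  -- measurable `τ`, so the supporting property survives on `G`.
  obtain ⟨N, hNsub, hNm, hN0⟩ := exists_measurable_superset_of_null (ae_iff.1 hae)
  set G := frontier Ω \ N with hG
  have hGm : MeasurableSet G := isClosed_frontier.measurableSet.diff hNm
  have hGτ : ∀ x ∈ G, tangentAngle Ω x = τ x := fun x hx => by
    by_contra hne
    exact hx.2 (hNsub hne)
  have hfield : IsNormalField G (outerNormalAngle z τ) :=
    isNormalField_outerNormalAngle hconv hz Set.sdiff_subset fun x hx => by
      rw [show τ x = tangentAngle Ω x from (hGτ x hx).symm]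
      exact tangentAngle_mem hconv hx.1
  have hGfin : Measure.hausdorffMeasure 1 G ≠ ∞ :=
    ne_top_of_le_ne_top hperim.ne (measure_mono Set.sdiff_subset)
  have hdiff : frontier Ω =ᵐ[Measure.hausdorffMeasure 1] G := by
    refine (sdiff_null_ae_eq_self (s := frontier Ω) (t := frontier Ω ∩ N) ?_).symm.trans ?_
    · rwa [Set.inter_comm, ← Measure.restrict_apply hNm]
    · rw [Set.sdiff_self_inter]
      exact Filter.EventuallyEq.rfl
  calc ∫⁻ x in frontier Ω, ENNReal.ofReal |Real.cos (θ - tangentAngle Ω x)|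
        ∂Measure.hausdorffMeasure 1
      = ∫⁻ x in G, ENNReal.ofReal |Real.cos (θ - tangentAngle Ω x)|
        ∂Measure.hausdorffMeasure 1 := setLIntegral_congr hdiff
    _ = ∫⁻ x in G, ENNReal.ofReal |Real.sin (outerNormalAngle z τ x - θ)|
        ∂Measure.hausdorffMeasure 1 := by
        refine setLIntegral_congr_fun hGm fun x hx => ?_
        simp only [abs_sin_outerNormalAngle, hGτ x hx]
    _ ≤ 2 * volume (coord θ '' G) :=
        hfield.lintegral_abs_sin_le_two_mul hGm (measurable_outerNormalAngle z hτm) hGfin θ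
    _ ≤ 2 * volume (coord θ '' Ω) := by
        gcongr 2 * ?_
        refine le_trans (measure_mono (Set.image_mono ?_)) (volume_coord_image_closure_le hconv θ)
        exact Set.sdiff_subset.trans frontier_subset_closure

/-! ### The cosine transform of a measure on the circle -/

instance fact_two_pi_pos : Fact (0 < 2 * Real.pi) := ⟨Real.two_pi_pos⟩

/-- The function `θ ↦ |cos θ|` on the circle. -/
def absCos (t : Torus) : ℝ := |(fourier 1 t).re|

theorem continuous_absCos : Continuous absCos :=
  (Complex.continuous_re.comp (fourier 1).continuous).abs

theorem fourier_coe_eq (n : ℤ) (x : ℝ) :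
    fourier n (x : Torus) = Complex.exp (n * x * Complex.I) := by
  rw [fourier_coe_apply]
  congr 1
  have := Real.pi_ne_zero
  push_cast
  field_simp

theorem absCos_coe (x : ℝ) : absCos (x : Torus) = |Real.cos x| := by
  rw [absCos, fourier_coe_eq, Int.cast_one, one_mul, Complex.exp_ofReal_mul_I_re]

theorem absCos_add_pi (t : Torus) : absCos (t + (Real.pi : ℝ)) = absCos t := by
  induction t using QuotientAddGroup.induction_on with
  | H x =>
    change absCos ((x : Torus) + (Real.pi : ℝ)) = absCos (x : Torus)
    rw [← AddCircle.coe_add, absCos_coe, absCos_coe, Real.cos_add_pi, abs_neg]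

theorem absCos_nonneg (t : Torus) : 0 ≤ absCos t := abs_nonneg _

theorem absCos_le_one (t : Torus) : absCos t ≤ 1 :=
  (Complex.abs_re_le_norm _).trans_eq (by rw [fourier_apply, Circle.norm_coe])

theorem fourier_add_pi (n : ℤ) (t : Torus) :
    fourier n (t + ((Real.pi : ℝ) : Torus)) = (-1) ^ n * fourier n t := by
  induction t using QuotientAddGroup.induction_on with
  | H x =>
    change fourier n ((x : Torus) + ((Real.pi : ℝ) : Torus)) = (-1) ^ n * fourier n (x : Torus)
    rw [← AddCircle.coe_add, fourier_coe_eq, fourier_coe_eq, Complex.ofReal_add, mul_add, add_mul,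
      Complex.exp_add, mul_comm, mul_assoc (n : ℂ), Complex.exp_int_mul, Complex.exp_pi_mul_I]

theorem fourier_eq_mul_sub (n : ℤ) (t s : Torus) :
    fourier n t = fourier n s * fourier n (t - s) := by
  simp only [fourier_apply]
  rw [← Circle.coe_mul, ← AddCircle.toCircle_add, ← smul_add, add_sub_cancel]

theorem norm_fourier_apply (n : ℤ) (t : Torus) : ‖fourier n t‖ = 1 := by
  rw [fourier_apply, Circle.norm_coe]

/-- The integral over the circle of a function with period `π`. -/
theorem integral_haarAddCircle_of_add_pi {E : Type*} [NormedAddCommGroup E] [NormedSpace ℝ E]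
    {f : Torus → E} (hf : Continuous f)
    (h : ∀ t, f (t + (Real.pi : ℝ)) = f t) (a : ℝ) :
    ∫ t, f t ∂AddCircle.haarAddCircle = Real.pi⁻¹ • ∫ x in a..a + Real.pi, f (x : Torus) := by
  have hper : Function.Periodic (fun x : ℝ => f (x : Torus)) Real.pi := fun x => by
    simp only [AddCircle.coe_add, h]
  have hc : Continuous fun x : ℝ => f (x : Torus) := hf.comp (AddCircle.continuous_mk' _)
  rw [AddCircle.integral_haarAddCircle, ← AddCircle.intervalIntegral_preimage _ a,
    show a + 2 * Real.pi = a + Real.pi + Real.pi by ring,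
    ← intervalIntegral.integral_add_adjacent_intervals (hc.intervalIntegrable _ (a + Real.pi))
      (hc.intervalIntegrable _ _), hper.intervalIntegral_add_eq (a + Real.pi) a, ← two_smul ℝ,
    smul_smul, mul_inv]
  congr 1
  ring

theorem integral_cos_mul_exp (m : ℤ) :
    ∫ x in (-(Real.pi / 2))..Real.pi / 2,
      Complex.exp ((-(2 * m) : ℤ) * x * Complex.I) * (Real.cos x : ℂ) =
      2 * (-1) ^ m / (1 - 4 * m ^ 2) := by
  have hne : (1 - 4 * m ^ 2 : ℂ) ≠ 0 := by
    have : (1 - 4 * m ^ 2 : ℤ) ≠ 0 := by omega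
    exact_mod_cast this
  -- An explicit antiderivative, from the ansatz of an exponential times a combination of `sin` and
  -- `cos`; the denominator is nonzero since `4m²` is even.
  set F : ℝ → ℂ := fun x => Complex.exp ((-(2 * m) : ℤ) * x * Complex.I) *
    (Complex.sin x - 2 * m * Complex.I * Complex.cos x) / (1 - 4 * m ^ 2) with hF
  have hderiv : ∀ x ∈ Set.uIcc (-(Real.pi / 2)) (Real.pi / 2), HasDerivAt F
      (Complex.exp ((-(2 * m) : ℤ) * x * Complex.I) * (Real.cos x : ℂ)) x := by
    intro x _
    have he : HasDerivAt (fun z : ℂ => Complex.exp ((-(2 * m) : ℤ) * z * Complex.I))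
        (Complex.exp ((-(2 * m) : ℤ) * x * Complex.I) * ((-(2 * m) : ℤ) * Complex.I)) (x : ℂ) := by
      have := (((hasDerivAt_id (x : ℂ)).const_mul ((-(2 * m) : ℤ) : ℂ)).mul_const Complex.I).cexp
      simpa using this
    have hs : HasDerivAt (fun z : ℂ => Complex.sin z - 2 * m * Complex.I * Complex.cos z)
        (Complex.cos x - 2 * m * Complex.I * -Complex.sin x) (x : ℂ) :=
      (Complex.hasDerivAt_sin _).sub ((Complex.hasDerivAt_cos _).const_mul _)
    have := ((he.mul hs).div_const (1 - 4 * m ^ 2 : ℂ)).comp_ofReal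
    refine this.congr_deriv ?_
    rw [div_eq_iff hne]
    push_cast
    linear_combination (4 * m ^ 2 * Complex.exp (-(2 * m) * x * Complex.I) * Complex.cos x) *
      Complex.I_sq
  rw [intervalIntegral.integral_eq_sub_of_hasDerivAt hderiv
    (Continuous.intervalIntegrable (by fun_prop) _ _)]
  have h1 : Complex.exp ((-(2 * m) : ℤ) * (Real.pi / 2 : ℝ) * Complex.I) = (-1) ^ m := by
    rw [show ((-(2 * m) : ℤ) * (Real.pi / 2 : ℝ) * Complex.I : ℂ) = (-m : ℤ) * (Real.pi * Complex.I) by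
      push_cast; ring, Complex.exp_int_mul, Complex.exp_pi_mul_I, zpow_neg, ← inv_zpow]
    norm_num
  have h2 : Complex.exp ((-(2 * m) : ℤ) * (-(Real.pi / 2) : ℝ) * Complex.I) = (-1) ^ m := by
    rw [show ((-(2 * m) : ℤ) * (-(Real.pi / 2) : ℝ) * Complex.I : ℂ) = (m : ℤ) * (Real.pi * Complex.I) by
      push_cast; ring, Complex.exp_int_mul, Complex.exp_pi_mul_I]
  simp only [hF]
  rw [h1, h2, ← Complex.ofReal_sin, ← Complex.ofReal_cos, ← Complex.ofReal_sin,
    ← Complex.ofReal_cos, Real.sin_neg, Real.cos_neg, Real.sin_pi_div_two, Real.cos_pi_div_two]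
  push_cast
  ring

theorem fourierCoeff_absCos (m : ℤ) :
    fourierCoeff (fun t : Torus => (absCos t : ℂ)) (2 * m) =
      Real.pi⁻¹ * (2 * (-1) ^ m / (1 - 4 * m ^ 2)) := by
  have hc : Continuous fun t : Torus => fourier (-(2 * m)) t • (absCos t : ℂ) :=
    (fourier _).continuous.smul (Complex.continuous_ofReal.comp continuous_absCos)
  rw [fourierCoeff, integral_haarAddCircle_of_add_pi hc _ (-(Real.pi / 2)),
    show -(Real.pi / 2) + Real.pi = Real.pi / 2 by ring, ← integral_cos_mul_exp m,
    Complex.real_smul]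
  · congr 1
    refine intervalIntegral.integral_congr fun x hx => ?_
    rw [Set.uIcc_of_le (by linarith [Real.pi_pos])] at hx
    rw [fourier_coe_eq, absCos_coe, abs_of_nonneg (Real.cos_nonneg_of_mem_Icc hx), smul_eq_mul]
  · intro t
    rw [fourier_add_pi, absCos_add_pi, zpow_neg, zpow_mul]
    norm_num

/-- The convolution of a measure on the circle with `|cos|`. -/
def cosTransform (μ : Measure Torus) (t : Torus) : ℝ := ∫ s, absCos (t - s) ∂μ

theorem cosTransform_nonneg (μ : Measure Torus) (t : Torus) : 0 ≤ cosTransform μ t :=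
  integral_nonneg fun _ => absCos_nonneg _

theorem cosTransform_add_pi (μ : Measure Torus) (t : Torus) :
    cosTransform μ (t + (Real.pi : ℝ)) = cosTransform μ t := by
  simp only [cosTransform, add_sub_right_comm, absCos_add_pi]

section CosTransform

variable (μ : Measure Torus) [IsFiniteMeasure μ]

theorem integrable_absCos_sub (t : Torus) : Integrable (fun s => absCos (t - s)) μ :=
  Integrable.of_bound (continuous_absCos.comp (continuous_const.sub continuous_id)).aestronglyMeasurable
    1 (Filter.Eventually.of_forall fun s => by
      rw [Real.norm_of_nonneg (absCos_nonneg _)]; exact absCos_le_one _)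

theorem continuous_cosTransform : Continuous (cosTransform μ) :=
  continuous_of_dominated (bound := fun _ => 1)
    (fun _ => (continuous_absCos.comp
      (continuous_const.sub continuous_id)).aestronglyMeasurable)
    (fun _ => Filter.Eventually.of_forall fun s => by
      rw [Real.norm_of_nonneg (absCos_nonneg _)]; exact absCos_le_one _)
    (integrable_const _)
    (Filter.Eventually.of_forall fun s =>
      continuous_absCos.comp (continuous_id.sub continuous_const))

theorem cosTransform_le (t : Torus) : cosTransform μ t ≤ μ.real Set.univ := by
  refine (integral_mono (integrable_absCos_sub μ t) (integrable_const 1)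
    fun s => absCos_le_one _).trans_eq ?_
  simp

theorem abs_cosTransform_sub_le (x y : ℝ) :
    |cosTransform μ x - cosTransform μ y| ≤ μ.real Set.univ * |x - y| := by
  rw [cosTransform, cosTransform,
    ← integral_sub (integrable_absCos_sub μ _) (integrable_absCos_sub μ _), ← Real.norm_eq_abs,
    mul_comm (μ.real Set.univ)]
  refine norm_integral_le_of_norm_le_const (Filter.Eventually.of_forall fun s => ?_)
  induction s using QuotientAddGroup.induction_on with
  | H z =>
    change ‖absCos ((x : Torus) - (z : ℝ)) - absCos ((y : Torus) - (z : ℝ))‖ ≤ _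
    rw [← AddCircle.coe_sub, ← AddCircle.coe_sub, absCos_coe, absCos_coe, Real.norm_eq_abs]
    refine (abs_abs_sub_abs_le _ _).trans ?_
    simpa [Real.dist_eq] using Real.lipschitzWith_cos.dist_le_mul (x - z) (y - z)

/-- The convolution theorem, by Fubini and translation invariance of Haar measure. -/
theorem fourierCoeff_cosTransform (n : ℤ) :
    fourierCoeff (fun t => (cosTransform μ t : ℂ)) n =
      (∫ s, fourier (-n) s ∂μ) * fourierCoeff (fun t : Torus => (absCos t : ℂ)) n := by
  have hint : Integrable (Function.uncurry fun t s : Torus =>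
      fourier (-n) t * (absCos (t - s) : ℂ)) (AddCircle.haarAddCircle.prod μ) := by
    have hc : Continuous (Function.uncurry fun t s : Torus =>
        fourier (-n) t * (absCos (t - s) : ℂ)) :=
      ((fourier _).continuous.comp continuous_fst).mul (Complex.continuous_ofReal.comp
        (continuous_absCos.comp (continuous_fst.sub continuous_snd)))
    refine Integrable.of_bound hc.aestronglyMeasurable 1 (Filter.Eventually.of_forall fun p => ?_)
    simp only [Function.uncurry]
    rw [norm_mul, norm_fourier_apply, one_mul, Complex.norm_real,
      Real.norm_of_nonneg (absCos_nonneg _)]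
    exact absCos_le_one _
  calc fourierCoeff (fun t => (cosTransform μ t : ℂ)) n
      = ∫ t, ∫ s, fourier (-n) t * (absCos (t - s) : ℂ) ∂μ ∂AddCircle.haarAddCircle := by
        simp only [fourierCoeff, cosTransform, smul_eq_mul]
        congr 1
        ext t
        rw [integral_const_mul, integral_complex_ofReal]
    _ = ∫ s, ∫ t, fourier (-n) t * (absCos (t - s) : ℂ) ∂AddCircle.haarAddCircle ∂μ :=
        integral_integral_swap hint
    _ = ∫ s, fourier (-n) s * fourierCoeff (fun t : Torus => (absCos t : ℂ)) n ∂μ := by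
        congr 1
        ext s
        rw [fourierCoeff, 
          ← integral_sub_right_eq_self (fun t => fourier (-n) t • (absCos t : ℂ)) s,
          ← integral_const_mul]
        congr 1
        ext t
        rw [fourier_eq_mul_sub (-n) t s, smul_eq_mul, mul_assoc]
    _ = _ := integral_mul_const _ _

end CosTransform

theorem integral_fourier_eq_zero_of_odd {μ : Measure Torus}
    (hμ : μ.map (fun t => t + ((Real.pi : ℝ) : Torus)) = μ) {n : ℤ} (hn : Odd n) :
    ∫ s, fourier n s ∂μ = 0 := by
  have h : ∫ s, fourier n s ∂μ = -∫ s, fourier n s ∂μ := by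
    conv_lhs => rw [← hμ]
    rw [integral_map (measurable_add_const _).aemeasurable
      (fourier n).continuous.aestronglyMeasurable, ← integral_neg]
    congr 1
    ext s
    rw [fourier_add_pi, hn.neg_one_zpow, neg_one_mul]
  exact self_eq_neg.1 h

/-- The graph of `G` lies above the triangle with apex `(x, G x)` and slopes `±K`, whose area is `G
x ^ 2 / K`. The hypothesis `hr` makes its base fit into the interval of radius `r`. -/
theorem sq_le_mul_integral_of_lipschitz {G : ℝ → ℝ} {K x : ℝ} (hK : 0 ≤ K)
    (hLip : ∀ y z, |G y - G z| ≤ K * |y - z|) (h0 : ∀ y, 0 ≤ G y) {r : ℝ} (hr : G x ≤ K * r) :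
    G x ^ 2 ≤ K * ∫ y in (x - r)..x + r, G y := by
  have hcont : Continuous G :=
    (LipschitzWith.of_dist_le_mul (K := K.toNNReal) fun y z => by
      rw [Real.dist_eq, Real.dist_eq, Real.coe_toNNReal _ hK]; exact hLip y z).continuous
  set M := G x with hM
  rcases hK.eq_or_lt with rfl | hKpos
  · have : M = 0 := le_antisymm (by simpa using hr) (h0 x)
    simp [this]
  set ρ := M / K with hρ
  have hρ0 : 0 ≤ ρ := div_nonneg (h0 x) hK
  have hρr : ρ ≤ r := (div_le_iff₀ hKpos).2 (by linarith)
  have hii : ∀ a b, IntervalIntegrable G volume a b := fun a b => hcont.intervalIntegrable _ _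
  have h1 : ∫ y in (x - ρ)..x + ρ, G y ≤ ∫ y in (x - r)..x + r, G y :=
    intervalIntegral.integral_mono_interval (by linarith) (by linarith) (by linarith)
      (Filter.Eventually.of_forall h0) (hii _ _)
  have h2 : ∫ y in (x - ρ)..x, (M + K * (y - x)) ≤ ∫ y in (x - ρ)..x, G y := by
    refine intervalIntegral.integral_mono_on (by linarith)
      (Continuous.intervalIntegrable (by fun_prop) _ _) (hii _ _) fun y hy => ?_
    have := (abs_le.1 (hLip x y)).2
    rw [abs_of_nonneg (by linarith [hy.2])] at this
    linarith
  have h3 : ∫ y in x..x + ρ, (M - K * (y - x)) ≤ ∫ y in x..x + ρ, G y := by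
    refine intervalIntegral.integral_mono_on (by linarith)
      (Continuous.intervalIntegrable (by fun_prop) _ _) (hii _ _) fun y hy => ?_
    have := (abs_le.1 (hLip x y)).2
    rw [abs_sub_comm, abs_of_nonneg (by linarith [hy.1])] at this
    linarith
  have h4 : ∫ y in (x - ρ)..x, (M + K * (y - x)) = M * ρ - K * ρ ^ 2 / 2 := by
    rw [intervalIntegral.integral_comp_sub_right (fun y => M + K * y) x,
      intervalIntegral.integral_add (by simp) (Continuous.intervalIntegrable (by fun_prop) _ _),
      intervalIntegral.integral_const_mul, integral_id, intervalIntegral.integral_const]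
    simp only [smul_eq_mul]
    ring
  have h5 : ∫ y in x..x + ρ, (M - K * (y - x)) = M * ρ - K * ρ ^ 2 / 2 := by
    rw [intervalIntegral.integral_comp_sub_right (fun y => M - K * y) x,
      intervalIntegral.integral_sub (by simp) (Continuous.intervalIntegrable (by fun_prop) _ _),
      intervalIntegral.integral_const_mul, integral_id, intervalIntegral.integral_const]
    simp only [smul_eq_mul]
    ring
  rw [← intervalIntegral.integral_add_adjacent_intervals (hii _ x) (hii x _)] at h1
  have h6 : K * (M * ρ - K * ρ ^ 2 / 2 + (M * ρ - K * ρ ^ 2 / 2)) = M ^ 2 := by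
    rw [hρ]; field_simp; ring
  rw [← h6]
  refine mul_le_mul_of_nonneg_left ?_ hK
  linarith

/-- Invariance of a measure on the circle under the half turn. -/
def IsHalfTurnInvariant (μ : Measure Torus) : Prop :=
  μ.map (fun t => t + ((Real.pi : ℝ) : Torus)) = μ

theorem integral_cosTransform (μ : Measure Torus) [IsFiniteMeasure μ] :
    ∫ t, cosTransform μ t ∂AddCircle.haarAddCircle = 2 / Real.pi * μ.real Set.univ := by
  -- The mean is the coefficient at zero, written `2 * 0` to match the formula for even indices.
  have h := fourierCoeff_cosTransform μ (2 * 0)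
  rw [fourierCoeff_absCos] at h
  simp only [fourierCoeff, mul_zero, neg_zero, fourier_zero, one_smul, integral_complex_ofReal,
    integral_const, zpow_zero, Int.cast_zero, Complex.real_smul] at h
  have h' : ((∫ t, cosTransform μ t ∂AddCircle.haarAddCircle : ℝ) : ℂ) =
      ((2 / Real.pi * μ.real Set.univ : ℝ) : ℂ) := by
    rw [h]
    push_cast
    ring
  exact_mod_cast h'

/-! ### Comparison of the norm with the mean square of the transforms -/

theorem fourierCoeff_cosTransform_sub (μ ν : Measure Torus) [IsFiniteMeasure μ] [IsFiniteMeasure ν]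
    (n : ℤ) :
    fourierCoeff (fun t => ((cosTransform μ t - cosTransform ν t : ℝ) : ℂ)) n =
      (∫ s, fourier (-n) s ∂μ - ∫ s, fourier (-n) s ∂ν) *
        fourierCoeff (fun t : Torus => (absCos t : ℂ)) n := by
  have hi : ∀ ρ : Measure Torus, IsFiniteMeasure ρ → Integrable
      (fun t => fourier (-n) t • (cosTransform ρ t : ℂ)) AddCircle.haarAddCircle := by
    intro ρ _
    exact ((fourier _).continuous.smul (Complex.continuous_ofReal.comp
      (continuous_cosTransform ρ))).integrable_of_hasCompactSupport
        (HasCompactSupport.of_compactSpace _)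
  rw [sub_mul, ← fourierCoeff_cosTransform, ← fourierCoeff_cosTransform, fourierCoeff,
    fourierCoeff, fourierCoeff, ← integral_sub (hi μ inferInstance) (hi ν inferInstance)]
  simp only [Complex.ofReal_sub, smul_sub]

/-- For `l = 2m` the claim is `1/(16m⁴) ≤ 1/(4m² - 1)²`; the constant comes from `1/(2π) =
(π/8)(2/π)²`. For odd `l` half-turn invariance makes the left side zero. -/
theorem norm_sub_sq_div_le {μ ν : Measure Torus} [IsFiniteMeasure μ] [IsFiniteMeasure ν]
    (hμ : IsHalfTurnInvariant μ) (hν : IsHalfTurnInvariant ν) {l : ℤ} (hl : l ≠ 0) :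
    ‖fourierCoeffMeasure μ l - fourierCoeffMeasure ν l‖ ^ 2 / (l : ℝ) ^ 4 ≤
      Real.pi / 8 *
        ‖fourierCoeff (fun t => ((cosTransform μ t - cosTransform ν t : ℝ) : ℂ)) l‖ ^ 2 := by
  have hpi := Real.pi_pos
  rw [fourierCoeffMeasure, fourierCoeffMeasure, ← mul_sub, fourierCoeff_cosTransform_sub]
  rcases Int.even_or_odd' l with ⟨m, rfl | rfl⟩
  · have hm : m ≠ 0 := by rintro rfl; exact hl rfl
    have hm1 : (1 : ℝ) ≤ (m : ℝ) ^ 2 := by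
      have : 1 ≤ m ^ 2 := Int.add_one_le_of_lt (sq_pos_of_ne_zero hm)
      exact_mod_cast this
    rw [fourierCoeff_absCos]
    set N := ∫ s, fourier (-(2 * m)) s ∂μ - ∫ s, fourier (-(2 * m)) s ∂ν with hN
    have hc : ‖(Real.pi⁻¹ * (2 * (-1) ^ m / (1 - 4 * m ^ 2)) : ℂ)‖ =
        2 / (Real.pi * (4 * (m : ℝ) ^ 2 - 1)) := by
      have h1 : (1 - 4 * m ^ 2 : ℂ) = ((1 - 4 * (m : ℝ) ^ 2 : ℝ) : ℂ) := by push_cast; rfl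
      rw [h1, norm_mul, norm_div, norm_mul, norm_zpow, norm_neg, norm_one, one_zpow,
        Complex.norm_real, Complex.norm_real, Real.norm_of_nonneg (inv_nonneg.2 hpi.le),
        Real.norm_of_nonpos (by linarith), Complex.norm_two]
      have : (4 * (m : ℝ) ^ 2 - 1) ≠ 0 := by linarith
      rw [neg_sub]
      field_simp
    rw [norm_mul, norm_mul, hc, Complex.norm_real, Real.norm_of_nonneg (by positivity), mul_pow,
      mul_pow, div_pow, one_pow, Real.sq_sqrt (by positivity), div_pow, mul_pow Real.pi]
    have h2 : (0 : ℝ) < 4 * (m : ℝ) ^ 2 - 1 := by linarith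
    have h3 : (1 : ℝ) / (16 * (m : ℝ) ^ 4) ≤ 1 / (4 * (m : ℝ) ^ 2 - 1) ^ 2 := by
      refine one_div_le_one_div_of_le (by positivity) ?_
      nlinarith
    have h4 := mul_le_mul_of_nonneg_left h3
      (show 0 ≤ ‖N‖ ^ 2 / (2 * Real.pi) by positivity)
    have hm0 : (m : ℝ) ≠ 0 := by exact_mod_cast hm
    calc _ = ‖N‖ ^ 2 / (2 * Real.pi) * (1 / (16 * (m : ℝ) ^ 4)) := by
          push_cast
          field_simp
          ring
      _ ≤ _ := h4
      _ = _ := by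
          field_simp
          ring
  · have hodd : Odd (-(2 * m + 1)) := (odd_two_mul_add_one m).neg
    rw [integral_fourier_eq_zero_of_odd hμ hodd, integral_fourier_eq_zero_of_odd hν hodd]
    simp

theorem hNegTwoDist_sq_le {μ ν : Measure Torus} [IsFiniteMeasure μ] [IsFiniteMeasure ν]
    (hμ : IsHalfTurnInvariant μ) (hν : IsHalfTurnInvariant ν) :
    hNegTwoDist μ ν ^ 2 ≤ Real.pi / 8 *
      ∫ t, (cosTransform μ t - cosTransform ν t) ^ 2 ∂AddCircle.haarAddCircle := by
  set g : C(Torus, ℂ) := ⟨fun t => ((cosTransform μ t - cosTransform ν t : ℝ) : ℂ),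
    Complex.continuous_ofReal.comp
      ((continuous_cosTransform μ).sub (continuous_cosTransform ν))⟩ with hg
  have hP := hasSum_sq_fourierCoeff (ContinuousMap.toLp 2 AddCircle.haarAddCircle ℂ g)
  have hint : ∫ t, ‖(ContinuousMap.toLp 2 AddCircle.haarAddCircle ℂ g) t‖ ^ 2
      ∂AddCircle.haarAddCircle =
      ∫ t, (cosTransform μ t - cosTransform ν t) ^ 2 ∂AddCircle.haarAddCircle := by
    refine integral_congr_ae ?_
    filter_upwards [ContinuousMap.coeFn_toLp (p := 2) (𝕜 := ℂ) AddCircle.haarAddCircle g] with t ht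
    rw [ht]
    simp only [hg, ContinuousMap.coe_mk, Complex.norm_real, Real.norm_eq_abs, sq_abs]
  rw [hint] at hP
  simp only [fourierCoeff_toLp] at hP
  have hP' := hP.mul_left (Real.pi / 8)
  rw [hNegTwoDist, Real.sq_sqrt (tsum_nonneg fun l => by positivity), ← hP'.tsum_eq]
  -- Termwise comparison over `l ≠ 0`; adding the nonnegative term at `l = 0` completes the Parseval
  -- sum.
  refine le_trans ((summable_hNegTwoDist μ ν).tsum_le_tsum
    (fun l => norm_sub_sq_div_le hμ hν l.2) (hP'.summable.subtype _)) ?_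
  exact hP'.summable.tsum_subtype_le _ _ fun l => by positivity

/-! ### Consequences of a pointwise inequality between transforms -/

theorem integral_cosTransform_sub (μ ν : Measure Torus) [IsFiniteMeasure μ] [IsFiniteMeasure ν] :
    ∫ t, (cosTransform μ t - cosTransform ν t) ∂AddCircle.haarAddCircle =
      2 / Real.pi * (μ.real Set.univ - ν.real Set.univ) := by
  have hi : ∀ ρ : Measure Torus, IsFiniteMeasure ρ → Integrable
      (fun t => cosTransform ρ t) AddCircle.haarAddCircle := fun ρ _ =>
    (continuous_cosTransform ρ).integrable_of_hasCompactSupport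
      (HasCompactSupport.of_compactSpace _)
  rw [integral_sub (hi μ inferInstance) (hi ν inferInstance), integral_cosTransform,
    integral_cosTransform, mul_sub]

theorem measureReal_univ_le_of_cosTransform_le {μ ν : Measure Torus} [IsFiniteMeasure μ]
    [IsFiniteMeasure ν] (h : ∀ t, cosTransform ν t ≤ cosTransform μ t) :
    ν.real Set.univ ≤ μ.real Set.univ := by
  have h1 : 0 ≤ 2 / Real.pi * (μ.real Set.univ - ν.real Set.univ) := by
    rw [← integral_cosTransform_sub]
    exact integral_nonneg fun t => sub_nonneg.2 (h t)
  have := Real.pi_pos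
  exact sub_nonneg.1 (nonneg_of_mul_nonneg_right h1 (by positivity))

theorem cosTransform_sub_sq_le {μ ν : Measure Torus} [IsFiniteMeasure μ]
    [IsFiniteMeasure ν] (h : ∀ t, cosTransform ν t ≤ cosTransform μ t) (t : Torus) :
    (cosTransform μ t - cosTransform ν t) ^ 2 ≤
      4 * μ.real Set.univ * (μ.real Set.univ - ν.real Set.univ) := by
  have hpi := Real.pi_pos
  set L := μ.real Set.univ with hL
  have hL0 : 0 ≤ L := measureReal_nonneg
  have hPL : ν.real Set.univ ≤ L := measureReal_univ_le_of_cosTransform_le h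
  induction t using QuotientAddGroup.induction_on with
  | H x =>
    set g : Torus → ℝ := fun t => cosTransform μ t - cosTransform ν t with hg
    have hgc : Continuous g := (continuous_cosTransform μ).sub (continuous_cosTransform ν)
    have hI := integral_haarAddCircle_of_add_pi hgc
      (fun t => by simp only [hg, cosTransform_add_pi]) (x - Real.pi / 2)
    rw [show x - Real.pi / 2 + Real.pi = x + Real.pi / 2 by ring, integral_cosTransform_sub,
      smul_eq_mul] at hI
    have hLip : ∀ y z : ℝ, |g (y : Torus) - g (z : Torus)| ≤ 2 * L * |y - z| := by
      intro y z
      have h1 := abs_cosTransform_sub_le μ y z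
      have h2 := abs_cosTransform_sub_le ν y z
      have h3 : ν.real Set.univ * |y - z| ≤ L * |y - z| := by gcongr
      simp only [hg]
      rw [sub_sub_sub_comm]
      refine (abs_sub _ _).trans ?_
      linarith
    -- The triangle at `x` fits into one period, because `g ≤ L ≤ π L`.
    have hr : g (x : Torus) ≤ 2 * L * (Real.pi / 2) := by
      have h1 := cosTransform_le μ (x : Torus)
      have h2 := cosTransform_nonneg ν (x : Torus)
      have h3 : L * 1 ≤ L * Real.pi := by gcongr; linarith [Real.pi_gt_three]
      simp only [hg]
      linarith
    have key := sq_le_mul_integral_of_lipschitz (G := fun y : ℝ => g (y : Torus)) (x := x)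
      (by positivity) hLip (fun y => sub_nonneg.2 (h _)) hr
    have hI' : ∫ y in (x - Real.pi / 2)..x + Real.pi / 2, g (y : Torus) =
        2 * (L - ν.real Set.univ) := by
      rw [inv_mul_eq_div, eq_div_iff hpi.ne'] at hI
      rw [← hI]
      field_simp
      rw [hL]
    rw [hI'] at key
    exact key.trans_eq (by ring)

theorem hNegTwoDist_le_of_cosTransform_le {μ ν : Measure Torus} [IsFiniteMeasure μ]
    [IsFiniteMeasure ν] (hμ : IsHalfTurnInvariant μ) (hν : IsHalfTurnInvariant ν)
    (h : ∀ t, cosTransform ν t ≤ cosTransform μ t) :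
    hNegTwoDist μ ν ≤ μ.real Set.univ ^ (1 / 4 : ℝ) / Real.sqrt 2 *
      (μ.real Set.univ - ν.real Set.univ) ^ (3 / 4 : ℝ) := by
  have hpi := Real.pi_pos
  have hPL := measureReal_univ_le_of_cosTransform_le h
  have hint := integral_cosTransform_sub μ ν
  have hbound := cosTransform_sub_sq_le h
  have hsq := hNegTwoDist_sq_le hμ hν
  set L := μ.real Set.univ with hL
  set δ := L - ν.real Set.univ with hδ
  have hL0 : 0 ≤ L := measureReal_nonneg
  have hδ0 : 0 ≤ δ := sub_nonneg.2 hPL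
  -- `M` is the uniform bound for the difference of the transforms; its square is at most `M` times
  -- the difference itself, whose integral is known.
  set M := 2 * L ^ (1 / 2 : ℝ) * δ ^ (1 / 2 : ℝ) with hM
  have hM0 : 0 ≤ M := by positivity
  have hM2 : M ^ 2 = 4 * L * δ := by
    rw [hM, mul_pow, mul_pow, ← Real.sqrt_eq_rpow, ← Real.sqrt_eq_rpow, Real.sq_sqrt hL0,
      Real.sq_sqrt hδ0]
    ring
  have hgc : Continuous fun t => cosTransform μ t - cosTransform ν t :=
    (continuous_cosTransform μ).sub (continuous_cosTransform ν)
  have h1 : ∫ t, (cosTransform μ t - cosTransform ν t) ^ 2 ∂AddCircle.haarAddCircle ≤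
      M * (2 / Real.pi * δ) := by
    rw [← hint, ← integral_const_mul]
    refine integral_mono
      ((hgc.pow 2).integrable_of_hasCompactSupport (HasCompactSupport.of_compactSpace _))
      ((continuous_const.mul hgc).integrable_of_hasCompactSupport
        (HasCompactSupport.of_compactSpace _)) fun t => ?_
    have h2 : cosTransform μ t - cosTransform ν t ≤ M :=
      abs_le_of_sq_le_sq' ((hbound t).trans_eq hM2.symm) hM0 |>.2
    simp only
    rw [sq]
    exact mul_le_mul_of_nonneg_right h2 (sub_nonneg.2 (h t))
  refine (sq_le_sq₀ (Real.sqrt_nonneg _) (by positivity)).1 ?_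
  calc hNegTwoDist μ ν ^ 2 ≤ Real.pi / 8 * (M * (2 / Real.pi * δ)) := by
        refine hsq.trans ?_
        gcongr
    _ = L ^ (1 / 2 : ℝ) / 2 * (δ ^ (1 / 2 : ℝ) * δ) := by
        rw [hM]
        field_simp
        ring
    _ = L ^ (1 / 2 : ℝ) / 2 * δ ^ (3 / 2 : ℝ) := by
        rw [show (3 / 2 : ℝ) = 1 / 2 + 1 by norm_num,
          Real.rpow_add_of_nonneg hδ0 (by norm_num) zero_le_one, Real.rpow_one]
    _ = (L ^ (1 / 4 : ℝ) / Real.sqrt 2 * δ ^ (3 / 4 : ℝ)) ^ 2 := by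
        rw [mul_pow, div_pow, Real.sq_sqrt (by norm_num), ← Real.rpow_mul_natCast hL0,
          ← Real.rpow_mul_natCast hδ0]
        norm_num

/-! ### The measures of a segment family and of a boundary -/

theorem isHalfTurnInvariant_twoSidedDirac (α : ℝ) : IsHalfTurnInvariant (twoSidedDirac α) := by
  have hm : Measurable fun t : Torus => t + ((Real.pi : ℝ) : Torus) := measurable_add_const _
  have h1 : (α : Torus) + ((Real.pi : ℝ) : Torus) = ((Real.pi + α : ℝ) : Torus) := by
    rw [← AddCircle.coe_add, add_comm]
  have h2 : ((Real.pi + α : ℝ) : Torus) + ((Real.pi : ℝ) : Torus) = (α : Torus) := by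
    rw [← AddCircle.coe_add, show Real.pi + α + Real.pi = α + 2 * Real.pi by ring,
      AddCircle.coe_add, AddCircle.coe_period, add_zero]
  rw [IsHalfTurnInvariant, twoSidedDirac, Measure.map_smul, Measure.map_add _ _ hm,
    Measure.map_dirac' hm, Measure.map_dirac' hm, h1, h2, add_comm]

theorem isHalfTurnInvariant_segmentsMeasure {ι : Type*} (p q : ι → Plane) :
    IsHalfTurnInvariant (segmentsMeasure p q) := by
  have hm : Measurable fun t : Torus => t + ((Real.pi : ℝ) : Torus) := measurable_add_const _
  refine Measure.ext fun s hs => ?_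
  rw [Measure.map_apply hm hs, segmentsMeasure, Measure.sum_apply _ (hm hs), Measure.sum_apply _ hs]
  refine tsum_congr fun i => ?_
  rw [Measure.smul_apply, Measure.smul_apply, ← Measure.map_apply hm hs,
    isHalfTurnInvariant_twoSidedDirac]

theorem aemeasurable_coe_tangentAngle {Ω : Set Plane} (hconv : Convex ℝ Ω)
    (hbdd : Bornology.IsBounded Ω) : AEMeasurable (fun x => (tangentAngle Ω x : Torus))
      ((Measure.hausdorffMeasure 1).restrict (frontier Ω)) :=
  (AddCircle.continuous_mk' _).measurable.comp_aemeasurable (aemeasurable_tangentAngle hconv hbdd)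

theorem aemeasurable_coe_pi_add_tangentAngle {Ω : Set Plane} (hconv : Convex ℝ Ω)
    (hbdd : Bornology.IsBounded Ω) :
    AEMeasurable (fun x => ((Real.pi + tangentAngle Ω x : ℝ) : Torus))
      ((Measure.hausdorffMeasure 1).restrict (frontier Ω)) :=
  (AddCircle.continuous_mk' _).measurable.comp_aemeasurable
    ((aemeasurable_tangentAngle hconv hbdd).const_add _)

theorem isHalfTurnInvariant_boundaryMeasure {Ω : Set Plane} (hconv : Convex ℝ Ω)
    (hbdd : Bornology.IsBounded Ω) : IsHalfTurnInvariant (boundaryMeasure Ω) := by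
  have hm : Measurable fun t : Torus => t + ((Real.pi : ℝ) : Torus) := measurable_add_const _
  rw [IsHalfTurnInvariant, boundaryMeasure, Measure.map_smul, Measure.map_smul,
    Measure.map_add _ _ hm,
    AEMeasurable.map_map_of_aemeasurable hm.aemeasurable (aemeasurable_coe_tangentAngle hconv hbdd),
    AEMeasurable.map_map_of_aemeasurable hm.aemeasurable
      (aemeasurable_coe_pi_add_tangentAngle hconv hbdd), add_comm]
  congr 4
  · ext x
    simp only [Function.comp]
    rw [← AddCircle.coe_add,
      show Real.pi + tangentAngle Ω x + Real.pi = tangentAngle Ω x + 2 * Real.pi by ring,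
      AddCircle.coe_add, AddCircle.coe_period, add_zero]
  · ext x
    simp only [Function.comp]
    rw [← AddCircle.coe_add, add_comm]

theorem lintegral_twoSidedDirac {f : Torus → ℝ≥0∞} (hf : Measurable f)
    (h : ∀ t, f (t + ((Real.pi : ℝ) : Torus)) = f t) (α : ℝ) :
    ∫⁻ s, f s ∂twoSidedDirac α = f α := by
  rw [twoSidedDirac, lintegral_smul_measure, lintegral_add_measure, lintegral_dirac' _ hf,
    lintegral_dirac' _ hf, add_comm Real.pi, AddCircle.coe_add, h, ← two_mul, smul_eq_mul,
    ← mul_assoc, one_div, ENNReal.inv_mul_cancel two_ne_zero ENNReal.ofNat_ne_top, one_mul]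

theorem lintegral_boundaryMeasure {Ω : Set Plane} (hconv : Convex ℝ Ω)
    (hbdd : Bornology.IsBounded Ω) {f : Torus → ℝ≥0∞} (hf : Measurable f)
    (h : ∀ t, f (t + ((Real.pi : ℝ) : Torus)) = f t) :
    ∫⁻ s, f s ∂boundaryMeasure Ω =
      2⁻¹ * ∫⁻ x in frontier Ω, f (tangentAngle Ω x) ∂Measure.hausdorffMeasure 1 := by
  have hshift : ∀ x, f ((Real.pi + tangentAngle Ω x : ℝ) : Torus) = f (tangentAngle Ω x) := by
    intro x
    rw [add_comm, AddCircle.coe_add, h]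
  rw [boundaryMeasure, lintegral_smul_measure, lintegral_smul_measure, lintegral_add_measure,
    lintegral_map' hf.aemeasurable (aemeasurable_coe_tangentAngle hconv hbdd),
    lintegral_map' hf.aemeasurable (aemeasurable_coe_pi_add_tangentAngle hconv hbdd)]
  simp only [hshift]
  rw [← two_mul, smul_eq_mul, smul_eq_mul, ← mul_assoc (1 / 2 : ℝ≥0∞) 2, one_div,
    ENNReal.inv_mul_cancel two_ne_zero ENNReal.ofNat_ne_top, one_mul]

/-- The length of the projection of `Ω` separates the two sides: Cauchy's inequality bounds it
below, opacity above. -/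
theorem lintegral_absCos_boundaryMeasure_le {ι : Type*} [Countable ι] {Ω : Set Plane}
    (hconv : Convex ℝ Ω) (hbdd : Bornology.IsBounded Ω) (hint : (interior Ω).Nonempty)
    {p q : ι → Plane} (hO : IsOpaque Ω (⋃ i, segment ℝ (p i) (q i))) (t : Torus) :
    ∫⁻ s, ENNReal.ofReal (absCos (t - s)) ∂boundaryMeasure Ω ≤
      ∫⁻ s, ENNReal.ofReal (absCos (t - s)) ∂segmentsMeasure p q := by
  have hf : Measurable fun s : Torus => ENNReal.ofReal (absCos (t - s)) :=
    ENNReal.measurable_ofReal.comp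
      (continuous_absCos.comp (continuous_const.sub continuous_id)).measurable
  have hper : ∀ s : Torus, ENNReal.ofReal (absCos (t - (s + ((Real.pi : ℝ) : Torus)))) =
      ENNReal.ofReal (absCos (t - s)) := by
    intro s
    rw [← absCos_add_pi, sub_add_eq_sub_sub, sub_add_cancel]
  rw [lintegral_boundaryMeasure hconv hbdd hf hper, segmentsMeasure, lintegral_sum_measure]
  simp only [lintegral_smul_measure, lintegral_twoSidedDirac hf hper]
  induction t using QuotientAddGroup.induction_on with
  | H θ =>
    have hcos : ∀ α : ℝ, absCos (((θ : ℝ) : Torus) - (α : Torus)) = |Real.cos (θ - α)| := by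
      intro α
      rw [← AddCircle.coe_sub, absCos_coe]
    calc 2⁻¹ * ∫⁻ x in frontier Ω, ENNReal.ofReal (absCos (((θ : ℝ) : Torus) - tangentAngle Ω x))
          ∂Measure.hausdorffMeasure 1
        ≤ 2⁻¹ * (2 * volume (coord θ '' Ω)) := by
          simp only [hcos]
          gcongr
          exact lintegral_abs_cos_tangentAngle_le hconv hbdd hint θ
      _ = volume (coord θ '' Ω) := by
          rw [← mul_assoc, ENNReal.inv_mul_cancel two_ne_zero ENNReal.ofNat_ne_top, one_mul]
      _ ≤ ∑' i, ENNReal.ofReal (dist (p i) (q i) * |Real.cos (θ - angle (q i - p i))|) :=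
          volume_coord_image_le_of_isOpaque hO θ
      _ = ∑' i, ENNReal.ofReal (dist (p i) (q i)) •
          ENNReal.ofReal (absCos (((θ : ℝ) : Torus) - (angle (q i - p i) : Torus))) := by
          simp only [hcos, ENNReal.ofReal_mul dist_nonneg, smul_eq_mul]

theorem cosTransform_eq_toReal_lintegral (μ : Measure Torus) (t : Torus) :
    cosTransform μ t = (∫⁻ s, ENNReal.ofReal (absCos (t - s)) ∂μ).toReal :=
  integral_eq_lintegral_of_nonneg_ae (Filter.Eventually.of_forall fun _ => absCos_nonneg _)
    (continuous_absCos.comp (continuous_const.sub continuous_id)).aestronglyMeasurable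

theorem cosTransform_boundaryMeasure_le {ι : Type*} [Countable ι] {Ω : Set Plane}
    (hconv : Convex ℝ Ω) (hbdd : Bornology.IsBounded Ω) (hint : (interior Ω).Nonempty)
    {p q : ι → Plane} [IsFiniteMeasure (segmentsMeasure p q)]
    (hO : IsOpaque Ω (⋃ i, segment ℝ (p i) (q i))) (t : Torus) :
    cosTransform (boundaryMeasure Ω) t ≤ cosTransform (segmentsMeasure p q) t := by
  rw [cosTransform_eq_toReal_lintegral, cosTransform_eq_toReal_lintegral]
  refine ENNReal.toReal_mono ?_ (lintegral_absCos_boundaryMeasure_le hconv hbdd hint hO t)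
  exact (integrable_absCos_sub _ t).lintegral_lt_top.ne

end Opaque

end

/-! ### The main theorem -/

theorem theorem2 {ι : Type*} [Countable ι] (Ω : Set Opaque.Plane)
    (hconv : Convex ℝ Ω) (hbdd : Bornology.IsBounded Ω) (hint : (interior Ω).Nonempty)
    (p q : ι → Opaque.Plane) (hO : Opaque.IsOpaque Ω (⋃ i, segment ℝ (p i) (q i)))
    (L : ℝ) (hL : HasSum (fun i => dist (p i) (q i)) L) :
    Opaque.perimeter Ω / 2 ≤ ENNReal.ofReal L ∧
    Opaque.hNegTwoDist (Opaque.segmentsMeasure p q) (Opaque.boundaryMeasure Ω) ≤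
      L ^ (1 / 4 : ℝ) / Real.sqrt 2 *
        (L - (Opaque.perimeter Ω).toReal / 2) ^ (3 / 4 : ℝ) := by
  have hL0 : 0 ≤ L := hL.nonneg fun i => dist_nonneg
  have hμuniv : Opaque.segmentsMeasure p q Set.univ = ENNReal.ofReal L := by
    rw [Opaque.segmentsMeasure_univ,
      ← ENNReal.ofReal_tsum_of_nonneg (fun i => dist_nonneg) hL.summable, hL.tsum_eq]
  have hνuniv := Opaque.boundaryMeasure_univ hconv hbdd
  have hperim := Opaque.perimeter_lt_top hconv hbdd hint
  have hμ : IsFiniteMeasure (Opaque.segmentsMeasure p q) := ⟨by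
    rw [hμuniv]; exact ENNReal.ofReal_lt_top⟩
  have hν : IsFiniteMeasure (Opaque.boundaryMeasure Ω) := ⟨by
    rw [hνuniv]; exact ENNReal.div_lt_top hperim.ne two_ne_zero⟩
  have hμreal : (Opaque.segmentsMeasure p q).real Set.univ = L := by
    rw [measureReal_def, hμuniv, ENNReal.toReal_ofReal hL0]
  have hνreal : (Opaque.boundaryMeasure Ω).real Set.univ = (Opaque.perimeter Ω).toReal / 2 := by
    rw [measureReal_def, hνuniv, ENNReal.toReal_div, ENNReal.toReal_ofNat]
  have hle := Opaque.cosTransform_boundaryMeasure_le hconv hbdd hint hO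
  constructor
  · rw [← hνuniv, ← ofReal_measureReal, ← hμreal]
    exact ENNReal.ofReal_le_ofReal (Opaque.measureReal_univ_le_of_cosTransform_le hle)
  · have := Opaque.hNegTwoDist_le_of_cosTransform_le
      (Opaque.isHalfTurnInvariant_segmentsMeasure p q)
      (Opaque.isHalfTurnInvariant_boundaryMeasure hconv hbdd) hle
    rwa [hμreal, hνreal] at this
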